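/- Let $F$ be an algebraically closed field of characteristic zero, and let $\sigma_x,\sigma_y$ be the shift automorphisms of the field $F(x,y)$ of rational functions, given by $\sigma_x(f(x,y))=f(x+1,y)$ and $\sigma_y(f(x,y))=f(x,y+1)$. A rational function $f\in F(x,y)$ is called $(\sigma_x,\sigma_y)$-summable in $F(x,y)$ if there exist $g,h\in F(x,y)$ such that $f=\sigma_x(g)-g+\sigma_y(h)-h$. For every integer $n\ge 1$, the rational function $\frac{1}{x^n+y^n}$ is $(\sigma_x,\sigma_y)$-summable in $F(x,y)$ if and only if $n=1$. For $n=1$ one has explicitly \[ \frac{1}{x+y}=\sigma_x\!\left(\frac{x}{x+y}\right)-\frac{x}{x+y}+\sigma_y\!\left(\frac{-x-1}{x+y}\right)-\frac{-x-1}{x+y}. \] -/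

import Mathlib

namespace BivariateSummability

/-- The polynomial ring `F[x, y]`; the variable `0` is `x` and the variable `1` is `y`. -/
abbrev BivPoly (F : Type*) [Field F] : Type _ := MvPolynomial (Fin 2) F

/-- The field `F(x, y)` of rational functions in two variables. -/
abbrev BivRat (F : Type*) [Field F] : Type _ := FractionRing (BivPoly F)

/-- The substitution `x ↦ x + c 0`, `y ↦ y + c 1` as an endomorphism of `F[x, y]`. -/
noncomputable def polyTranslateHom (F : Type*) [Field F] (c : Fin 2 → F) :
    BivPoly F →ₐ[F] BivPoly F :=
  MvPolynomial.aeval (fun i => MvPolynomial.X i + MvPolynomial.C (c i))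

theorem polyTranslateHom_comp (F : Type*) [Field F] (c d : Fin 2 → F) (h : c + d = 0) :
    (polyTranslateHom F c).comp (polyTranslateHom F d) = AlgHom.id F (BivPoly F) := by
  apply MvPolynomial.algHom_ext
  intro i
  have hi : c i + d i = 0 := congrFun h i
  simp only [polyTranslateHom, AlgHom.comp_apply, MvPolynomial.aeval_X, map_add,
    MvPolynomial.algHom_C, MvPolynomial.algebraMap_eq, AlgHom.id_apply]
  rw [add_assoc, ← MvPolynomial.C_add, hi, MvPolynomial.C_0, add_zero]

/-- The substitution `x ↦ x + c 0`, `y ↦ y + c 1` as an automorphism of `F[x, y]`. -/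
noncomputable def polyTranslate (F : Type*) [Field F] (c : Fin 2 → F) :
    BivPoly F ≃ₐ[F] BivPoly F :=
  AlgEquiv.ofAlgHom (polyTranslateHom F c) (polyTranslateHom F (-c))
    (polyTranslateHom_comp F c (-c) (add_neg_cancel c))
    (polyTranslateHom_comp F (-c) c (neg_add_cancel c))

/-- The automorphism `f(x, y) ↦ f(x + c 0, y + c 1)` of `F(x, y)`. -/
noncomputable def ratTranslate (F : Type*) [Field F] (c : Fin 2 → F) : BivRat F ≃ₐ[F] BivRat F :=
  IsFractionRing.algEquivOfAlgEquiv (polyTranslate F c)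

/-- The shift operator `σ_x : f(x, y) ↦ f(x + 1, y)` on `F(x, y)`. -/
noncomputable def shiftX (F : Type*) [Field F] : BivRat F ≃ₐ[F] BivRat F := ratTranslate F ![1, 0]

/-- The shift operator `σ_y : f(x, y) ↦ f(x, y + 1)` on `F(x, y)`. -/
noncomputable def shiftY (F : Type*) [Field F] : BivRat F ≃ₐ[F] BivRat F := ratTranslate F ![0, 1]

/-- The rational function `x`. -/
noncomputable def ratX (F : Type*) [Field F] : BivRat F :=
  algebraMap (BivPoly F) (BivRat F) (MvPolynomial.X 0)

/-- The rational function `y`. -/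
noncomputable def ratY (F : Type*) [Field F] : BivRat F :=
  algebraMap (BivPoly F) (BivRat F) (MvPolynomial.X 1)

/-- `f` is `(φ, ψ)`-summable in `F(x, y)`: there are `g, h ∈ F(x, y)` with
`f = φ(g) - g + ψ(h) - h`. -/
def IsSummable {F : Type*} [Field F] (φ ψ : BivRat F ≃ₐ[F] BivRat F) (f : BivRat F) : Prop :=
  ∃ g h : BivRat F, f = φ g - g + ψ h - h

end BivariateSummability

open BivariateSummability

namespace BivariateSummability
open Polynomial

variable {F : Type*} [Field F]

/-! For `n ≥ 2`, residues obstruct summability. Choose `ζ ^ n = -1` with `ζ ≠ -1`; then `ζ` is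
irrational, so distinct integer translates of the line `y = ζ x` are distinct lines. For any
rational `g`, take the residue along this line of each integer translate of `g`. Only finitely many
are nonzero (`residue_support_finite`), and shifting `g` merely reindexes them, so their sum
vanishes on summable functions (`IsSummable.finsum_residue_eq_zero`). For `1 / (x ^ n + y ^ n)` only
the untranslated residue survives, and it is nonzero because the pole is simple. -/

theorem polyTranslate_X (c : Fin 2 → F) (i : Fin 2) :
    polyTranslate F c (MvPolynomial.X i) = MvPolynomial.X i + MvPolynomial.C (c i) := by
  simp [polyTranslate, polyTranslateHom]

theorem ratTranslate_algebraMap (c : Fin 2 → F) (p : BivPoly F) :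
    ratTranslate F c (algebraMap (BivPoly F) (BivRat F) p) =
      algebraMap (BivPoly F) (BivRat F) (polyTranslate F c p) := by
  simp [ratTranslate]

theorem polyTranslate_polyTranslate (c d : Fin 2 → F) (p : BivPoly F) :
    polyTranslate F c (polyTranslate F d p) = polyTranslate F (c + d) p := by
  have h : ((polyTranslate F c : BivPoly F →ₐ[F] BivPoly F).comp
      (polyTranslate F d : BivPoly F →ₐ[F] BivPoly F)) =
      (polyTranslate F (c + d) : BivPoly F →ₐ[F] BivPoly F) := by
    apply MvPolynomial.algHom_ext
    intro i
    have hC : polyTranslate F c (MvPolynomial.C (d i)) = MvPolynomial.C (d i) :=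
      (polyTranslate F c).commutes (d i)
    simp [polyTranslate_X, hC, add_assoc]
  exact DFunLike.congr_fun h p

theorem ratTranslate_ratTranslate (c d : Fin 2 → F) (g : BivRat F) :
    ratTranslate F c (ratTranslate F d g) = ratTranslate F (c + d) g := by
  obtain ⟨p, q, _, rfl⟩ := IsFractionRing.div_surjective (A := BivPoly F) g
  simp only [map_div₀, ratTranslate_algebraMap, polyTranslate_polyTranslate]

theorem ratTranslate_ratX (c : Fin 2 → F) :
    ratTranslate F c (ratX F) = ratX F + algebraMap F (BivRat F) (c 0) := by
  rw [ratX, ratTranslate_algebraMap, polyTranslate_X, map_add, ← MvPolynomial.algebraMap_eq,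
    ← IsScalarTower.algebraMap_apply]

theorem ratTranslate_ratY (c : Fin 2 → F) :
    ratTranslate F c (ratY F) = ratY F + algebraMap F (BivRat F) (c 1) := by
  rw [ratY, ratTranslate_algebraMap, polyTranslate_X, map_add, ← MvPolynomial.algebraMap_eq,
    ← IsScalarTower.algebraMap_apply]

/-! ### Laurent expansion and residues along a line -/

/-- The substitution `x ↦ X`, `y ↦ ζ X + T`, as a map from `F[x, y]` to `F[X][T]`. -/
noncomputable def lineSubst (ζ : F) : BivPoly F →ₐ[F] F[X][X] :=
  MvPolynomial.aeval ![C X, C (C ζ * X) + X]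

/-- The substitution `T ↦ y - ζ x` gives a left inverse. -/
theorem lineSubst_injective (ζ : F) : Function.Injective (lineSubst ζ) := by
  let ψ : F[X][X] →+* BivPoly F :=
    Polynomial.eval₂RingHom (Polynomial.aeval (MvPolynomial.X 0 : BivPoly F)).toRingHom
      (MvPolynomial.X 1 - MvPolynomial.C ζ * MvPolynomial.X 0)
  have h : ψ.comp (lineSubst ζ).toRingHom = RingHom.id _ := by
    apply MvPolynomial.ringHom_ext
    · intro r
      have h1 : lineSubst ζ (MvPolynomial.C r) = C (C r) := (lineSubst ζ).commutes r
      simp [ψ, h1, MvPolynomial.algebraMap_eq]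
    · intro i
      fin_cases i <;> simp [ψ, lineSubst, MvPolynomial.algebraMap_eq]
  exact Function.LeftInverse.injective (g := ψ) fun p => DFunLike.congr_fun h p

/-- The inclusion of `F[X][T]` into the Laurent series in `T` over `F(X)`. -/
noncomputable def toLaurent (F : Type*) [Field F] : F[X][X] →+* LaurentSeries (RatFunc F) :=
  (HahnSeries.ofPowerSeries ℤ (RatFunc F)).comp
    (Polynomial.coeToPowerSeries.ringHom.comp (mapRingHom (algebraMap F[X] (RatFunc F))))

theorem toLaurent_injective : Function.Injective (toLaurent F) :=
  HahnSeries.ofPowerSeries_injective.comp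
    ((Polynomial.coe_injective _).comp
      (Polynomial.map_injective _ (RatFunc.algebraMap_injective F)))

/-- The expansion of a rational function as a Laurent series in `T = y - ζ x` over `F(x)`. -/
noncomputable def expand (ζ : F) : BivRat F →+* LaurentSeries (RatFunc F) :=
  IsFractionRing.lift (A := BivPoly F) (g := (toLaurent F).comp (lineSubst ζ).toRingHom)
    (toLaurent_injective.comp (lineSubst_injective ζ))

theorem expand_algebraMap (ζ : F) (p : BivPoly F) :
    expand ζ (algebraMap (BivPoly F) (BivRat F) p) = toLaurent F (lineSubst ζ p) := by
  simp [expand]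

/-- The residue along the line `y = ζ x` of the translate of `g` by `c`. -/
noncomputable def residue (ζ : F) (c : ℤ × ℤ) (g : BivRat F) : RatFunc F :=
  (expand ζ (ratTranslate F ![(c.1 : F), (c.2 : F)] g)).coeff (-1)

theorem residue_add (ζ : F) (c : ℤ × ℤ) (g h : BivRat F) :
    residue ζ c (g + h) = residue ζ c g + residue ζ c h := by
  simp [residue]

theorem residue_sub (ζ : F) (c : ℤ × ℤ) (g h : BivRat F) :
    residue ζ c (g - h) = residue ζ c g - residue ζ c h := by
  simp [residue]

/-- Translating before expanding makes a shift act on the index alone, leaving values in `F(X)`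
untouched. -/
theorem residue_shiftX (ζ : F) (c : ℤ × ℤ) (g : BivRat F) :
    residue ζ c (shiftX F g) = residue ζ (c + (1, 0)) g := by
  simp [residue, shiftX, ratTranslate_ratTranslate]

theorem residue_shiftY (ζ : F) (c : ℤ × ℤ) (g : BivRat F) :
    residue ζ c (shiftY F g) = residue ζ (c + (0, 1)) g := by
  simp [residue, shiftY, ratTranslate_ratTranslate]

/-- A nonzero constant coefficient makes the power series a unit, so no negative powers of `T`
appear. -/
theorem inv_toLaurent (q : F[X][X]) (hq : q.coeff 0 ≠ 0) :
    (toLaurent F q)⁻¹ = HahnSeries.ofPowerSeries ℤ (RatFunc F)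
      (q.map (algebraMap F[X] (RatFunc F)) : PowerSeries (RatFunc F))⁻¹ := by
  refine inv_eq_of_mul_eq_one_right ?_
  change HahnSeries.ofPowerSeries ℤ (RatFunc F)
    (q.map (algebraMap F[X] (RatFunc F)) : PowerSeries (RatFunc F)) * _ = 1
  rw [← map_mul, PowerSeries.mul_inv_cancel, map_one]
  rw [← PowerSeries.coeff_zero_eq_constantCoeff_apply, Polynomial.coeff_coe, coeff_map]
  simpa using hq

theorem toLaurent_div_coeff_neg_one (p q : F[X][X]) (hq : q.coeff 0 ≠ 0) :
    (toLaurent F p / toLaurent F q).coeff (-1) = 0 := by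
  rw [div_eq_mul_inv, inv_toLaurent q hq]
  change (HahnSeries.ofPowerSeries ℤ (RatFunc F)
    (p.map (algebraMap F[X] (RatFunc F)) : PowerSeries (RatFunc F)) * _).coeff (-1) = 0
  rw [← map_mul]
  exact (PowerSeries.coeff_coe _ _).trans (if_pos (by norm_num))

/-- A simple pole: the residue of `1 / q` at a simple zero of `q` does not vanish. -/
theorem one_div_toLaurent_coeff_neg_one_ne_zero (q : F[X][X]) (hq0 : q.coeff 0 = 0)
    (hq1 : q.coeff 1 ≠ 0) : (1 / toLaurent F q).coeff (-1) ≠ 0 := by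
  obtain ⟨q, rfl⟩ := X_dvd_iff.2 hq0
  have hq : q.coeff 0 ≠ 0 := by simpa using hq1
  have hX : toLaurent F X = HahnSeries.single (1 : ℤ) (1 : RatFunc F) := by
    simp [toLaurent]
  have h1 : HahnSeries.single (1 : ℤ) (1 : RatFunc F) * (1 / toLaurent F (X * q)) =
      (toLaurent F q)⁻¹ := by
    have hX0 : toLaurent F X ≠ 0 := (map_ne_zero_iff _ toLaurent_injective).2 X_ne_zero
    rw [← hX, map_mul]
    field_simp
  have h2 := HahnSeries.coeff_single_mul_add (r := (1 : RatFunc F))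
    (x := 1 / toLaurent F (X * q)) (a := -1) (b := (1 : ℤ))
  rw [h1, one_mul, inv_toLaurent q hq] at h2
  rw [← h2]
  have h3 := LaurentSeries.coeff_coe_powerSeries
    (q.map (algebraMap F[X] (RatFunc F)) : PowerSeries (RatFunc F))⁻¹ 0
  rw [Nat.cast_zero] at h3
  rw [neg_add_cancel, h3, PowerSeries.coeff_zero_eq_constantCoeff_apply,
    PowerSeries.constantCoeff_inv, ← PowerSeries.coeff_zero_eq_constantCoeff_apply,
    Polynomial.coeff_coe, coeff_map]
  simpa using hq

/-! ### Finiteness of the residues and their sum -/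

theorem coeff_zero_lineSubst_polyTranslate (ζ : F) (c : Fin 2 → F) (p : BivPoly F) :
    (lineSubst ζ (polyTranslate F c p)).coeff 0 =
      MvPolynomial.aeval ![X + C (c 0), C ζ * X + C (c 1)] p := by
  have h : ((constantCoeff : F[X][X] →+* F[X]).comp ((lineSubst ζ).toRingHom.comp
      (polyTranslate F c : BivPoly F →ₐ[F] BivPoly F).toRingHom)) =
      (MvPolynomial.aeval ![X + C (c 0), C ζ * X + C (c 1)] : BivPoly F →ₐ[F] F[X]).toRingHom := by
    have hC : ∀ r, lineSubst ζ (MvPolynomial.C r) = C (C r) := (lineSubst ζ).commutes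
    have hC' : ∀ r, polyTranslate F c (MvPolynomial.C r) = MvPolynomial.C r :=
      (polyTranslate F c).commutes
    apply MvPolynomial.ringHom_ext
    · intro r
      simp [hC, hC']
    · intro i
      fin_cases i <;> simp [polyTranslate_X, hC] <;> simp [lineSubst]
  exact DFunLike.congr_fun h p

/-- The line through `c` of slope `ζ` is `T = c 1 - ζ * c 0`. Hence `p` vanishes on it exactly when
this constant is a root of `p` as a polynomial in `T`, which bounds the number of such lines. -/
theorem eval_lineSubst (ζ : F) (c : Fin 2 → F) (p : BivPoly F) :
    (lineSubst ζ p).eval (C (c 1 - ζ * c 0)) =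
      ((lineSubst ζ (polyTranslate F c p)).coeff 0).comp (X - C (c 0)) := by
  rw [coeff_zero_lineSubst_polyTranslate]
  have h : ((evalRingHom (C (c 1 - ζ * c 0))).comp (lineSubst ζ).toRingHom) =
      (compRingHom (X - C (c 0))).comp
      (MvPolynomial.aeval ![X + C (c 0), C ζ * X + C (c 1)] : BivPoly F →ₐ[F] F[X]).toRingHom := by
    have hC : ∀ r, lineSubst ζ (MvPolynomial.C r) = C (C r) := (lineSubst ζ).commutes
    apply MvPolynomial.ringHom_ext
    · intro r
      simp [hC]
    · intro i
      fin_cases i <;> simp [lineSubst]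
      ring
  exact DFunLike.congr_fun h p

theorem finite_coeff_zero_eq_zero {ζ : F}
    (hζ : Function.Injective fun c : ℤ × ℤ => (c.2 : F) - ζ * c.1) {p : BivPoly F} (hp : p ≠ 0) :
    {c : ℤ × ℤ | (lineSubst ζ (polyTranslate F ![(c.1 : F), (c.2 : F)] p)).coeff 0 = 0}.Finite := by
  classical
  have hne : lineSubst ζ p ≠ 0 := (map_ne_zero_iff _ (lineSubst_injective ζ)).2 hp
  refine (((lineSubst ζ p).roots.toFinset.finite_toSet).preimage
    ((C_injective.comp hζ).injOn)).subset ?_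
  intro c hc
  have := eval_lineSubst ζ ![(c.1 : F), (c.2 : F)] p
  rw [hc.out, zero_comp] at this
  simpa [hne] using this

theorem residue_div_eq_zero (ζ : F) (c : ℤ × ℤ) (p q : BivPoly F)
    (h : (lineSubst ζ (polyTranslate F ![(c.1 : F), (c.2 : F)] q)).coeff 0 ≠ 0) :
    residue ζ c (algebraMap _ (BivRat F) p / algebraMap _ (BivRat F) q) = 0 := by
  rw [residue, map_div₀, map_div₀, ratTranslate_algebraMap, ratTranslate_algebraMap,
    expand_algebraMap, expand_algebraMap, toLaurent_div_coeff_neg_one _ _ h]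

theorem residue_support_finite {ζ : F}
    (hζ : Function.Injective fun c : ℤ × ℤ => (c.2 : F) - ζ * c.1) (g : BivRat F) :
    (Function.support fun c => residue ζ c g).Finite := by
  obtain ⟨p, q, hq, rfl⟩ := IsFractionRing.div_surjective (A := BivPoly F) g
  refine (finite_coeff_zero_eq_zero hζ (nonZeroDivisors.ne_zero hq)).subset fun c hc => ?_
  by_contra h
  exact hc (residue_div_eq_zero ζ c p q h)

/-- The sum of the residues over all integer translates of a summable function vanishes. -/
theorem IsSummable.finsum_residue_eq_zero {ζ : F}
    (hζ : Function.Injective fun c : ℤ × ℤ => (c.2 : F) - ζ * c.1) {f : BivRat F}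
    (hf : IsSummable (shiftX F) (shiftY F) f) : ∑ᶠ c, residue ζ c f = 0 := by
  obtain ⟨g, h, rfl⟩ := hf
  -- `∑ᶠ` is zero by convention on infinite supports, so additivity below needs finiteness.
  have hfin := residue_support_finite hζ
  have hX : ∑ᶠ c, residue ζ c (shiftX F g) = ∑ᶠ c, residue ζ c g := by
    simp only [residue_shiftX]
    exact finsum_comp_equiv (Equiv.addRight ((1, 0) : ℤ × ℤ)) (f := fun c => residue ζ c g)
  have hY : ∑ᶠ c, residue ζ c (shiftY F h) = ∑ᶠ c, residue ζ c h := by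
    simp only [residue_shiftY]
    exact finsum_comp_equiv (Equiv.addRight ((0, 1) : ℤ × ℤ)) (f := fun c => residue ζ c h)
  have hadd : ∀ a b : BivRat F,
      ∑ᶠ c, residue ζ c (a + b) = ∑ᶠ c, residue ζ c a + ∑ᶠ c, residue ζ c b := fun a b => by
    simp only [residue_add]
    exact finsum_add_distrib (hfin a) (hfin b)
  have hsub : ∀ a b : BivRat F,
      ∑ᶠ c, residue ζ c (a - b) = ∑ᶠ c, residue ζ c a - ∑ᶠ c, residue ζ c b := fun a b => by
    simp only [residue_sub]
    exact finsum_sub_distrib (hfin a) (hfin b)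
  rw [hsub, hadd, hsub, hX, hY]
  ring

/-! ### Choice of `ζ` and the case `n ≥ 2` -/

theorem exists_pow_eq_neg_one_ne_neg_one [IsAlgClosed F] [CharZero F] {n : ℕ} (hn : 2 ≤ n) :
    ∃ ζ : F, ζ ^ n = -1 ∧ ζ ≠ -1 := by
  obtain ⟨z, hz⟩ := IsAlgClosed.exists_pow_nat_eq (-1 : F) (show 0 < n by omega)
  have : NeZero (n : F) := ⟨by exact_mod_cast (show n ≠ 0 by omega)⟩
  obtain ⟨ω, hω⟩ := HasEnoughRootsOfUnity.exists_primitiveRoot F n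
  by_cases h : z = -1
  · refine ⟨z * ω, by rw [mul_pow, hz, hω.pow_eq_one, mul_one], fun h' => ?_⟩
    rw [h, neg_one_mul, neg_inj] at h'
    exact hω.ne_one (by omega) h'
  · exact ⟨z, hz, h⟩

/-- If `j = ζ i` with `i ≠ 0`, then `j ^ n = -i ^ n` forces `j = ± i`, so `ζ = ± 1`; both are
excluded. -/
theorem sub_mul_injective_of_pow_eq_neg_one [CharZero F] {n : ℕ} {ζ : F}
    (hζ : ζ ^ n = -1) (hζ' : ζ ≠ -1) :
    Function.Injective fun c : ℤ × ℤ => (c.2 : F) - ζ * c.1 := by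
  have hn : n ≠ 0 := by
    rintro rfl
    norm_num at hζ
  have key : ∀ i j : ℤ, (j : F) = ζ * i → i = 0 := by
    intro i j h
    have h1 : j ^ n = -i ^ n := by
      have : (j : F) ^ n = -(i : F) ^ n := by rw [h, mul_pow, hζ]; ring
      exact_mod_cast this
    have h2 : j.natAbs = i.natAbs := by
      have := congrArg Int.natAbs h1
      rw [Int.natAbs_neg, Int.natAbs_pow, Int.natAbs_pow] at this
      exact Nat.pow_left_injective hn this
    by_contra hi
    have hi' : (i : F) ≠ 0 := by exact_mod_cast hi
    rcases Int.natAbs_eq_natAbs_iff.1 h2 with rfl | rfl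
    · have : ζ = 1 := (mul_right_cancel₀ hi' (by rw [← h, one_mul]))
      rw [this, one_pow] at hζ
      norm_num at hζ
    · exact hζ' (mul_right_cancel₀ hi' (by rw [← h]; push_cast; ring))
  rintro ⟨a, b⟩ ⟨a', b'⟩ h
  simp only at h
  have h1 := key (a - a') (b - b') (by push_cast; linear_combination h)
  have h2 : a = a' := by omega
  subst h2
  have h3 : (b : F) = b' := by simpa using h
  rw [Prod.mk.injEq]
  exact ⟨rfl, by exact_mod_cast h3⟩

theorem not_isSummable_one_div_pow_add_pow [IsAlgClosed F] [CharZero F] {n : ℕ} (hn : 2 ≤ n) :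
    ¬ IsSummable (shiftX F) (shiftY F) (1 / (ratX F ^ n + ratY F ^ n)) := by
  intro hf
  obtain ⟨ζ, hζ, hζ'⟩ := exists_pow_eq_neg_one_ne_neg_one (F := F) hn
  have hinj := sub_mul_injective_of_pow_eq_neg_one hζ hζ'
  have hsum := hf.finsum_residue_eq_zero hinj
  set q : BivPoly F := MvPolynomial.X 0 ^ n + MvPolynomial.X 1 ^ n with hq
  have hfq : 1 / (ratX F ^ n + ratY F ^ n) =
      algebraMap _ (BivRat F) (1 : BivPoly F) / algebraMap _ (BivRat F) q := by
    simp [hq, ratX, ratY]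
  rw [hfq, finsum_eq_single _ 0] at hsum
  · have h0 : ratTranslate F ![(((0 : ℤ × ℤ).1 : ℤ) : F), (((0 : ℤ × ℤ).2 : ℤ) : F)] =
        ratTranslate F 0 := by
      congr 1
      ext i
      fin_cases i <;> simp
    have hid : ∀ p, polyTranslate F 0 p = p := fun p => by
      simp [polyTranslate, polyTranslateHom]
    rw [residue, h0, map_div₀, map_div₀, ratTranslate_algebraMap, ratTranslate_algebraMap,
      expand_algebraMap, expand_algebraMap, hid, hid, map_one, map_one] at hsum
    have hsub : lineSubst ζ q = C (X ^ n) + (C (C ζ * X) + X) ^ n := by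
      simp [hq, lineSubst]
    refine one_div_toLaurent_coeff_neg_one_ne_zero _ ?_ ?_ hsum
    · simp [hsub, coeff_zero_eq_eval_zero, mul_pow, ← map_pow, hζ]
    -- The coefficient of `T` is `n (ζ X) ^ (n - 1)`.
    · have hζ0 : ζ ≠ 0 := by
        rintro rfl
        simp [show n ≠ 0 by omega] at hζ
      rw [hsub, coeff_add, coeff_C_succ, zero_add, add_comm, coeff_X_add_C_pow]
      simp [hζ0, show n ≠ 0 by omega]
  · rintro ⟨i, j⟩ hc
    apply residue_div_eq_zero
    rw [coeff_zero_lineSubst_polyTranslate]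
    intro h
    apply hc
    -- At `X = -i` the term `(X + i) ^ n` drops out, leaving `(j - ζ i) ^ n`.
    have h1 := congrArg (Polynomial.eval (-(i : F))) h
    have h2 : ((j : F) - ζ * i) ^ n = 0 := by
      rw [← h1.trans eval_zero]
      simp [hq, show n ≠ 0 by omega]
      ring
    exact hinj (by simpa using pow_eq_zero_iff (by omega) |>.1 h2)

/-! ### The case `n = 1` -/

theorem ratX_add_ratY_add_ne_zero (c : F) :
    ratX F + ratY F + algebraMap F (BivRat F) c ≠ 0 := by
  have h : ratX F + ratY F + algebraMap F (BivRat F) c =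
      algebraMap (BivPoly F) _ (MvPolynomial.X 0 + MvPolynomial.X 1 + MvPolynomial.C c) := by
    simp only [ratX, ratY, map_add, ← MvPolynomial.algebraMap_eq,
      ← IsScalarTower.algebraMap_apply]
  rw [h, map_ne_zero_iff _ (IsFractionRing.injective _ _)]
  intro h0
  have := congrArg (MvPolynomial.eval ![1 - c, 0]) h0
  simp at this

theorem one_div_ratX_add_ratY :
    1 / (ratX F + ratY F) =
      shiftX F (ratX F / (ratX F + ratY F)) - ratX F / (ratX F + ratY F)
        + shiftY F ((-ratX F - 1) / (ratX F + ratY F)) - (-ratX F - 1) / (ratX F + ratY F) := by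
  have h0 : ratX F + ratY F ≠ 0 := by simpa using ratX_add_ratY_add_ne_zero (0 : F)
  have h1 : ratX F + ratY F + 1 ≠ 0 := by simpa using ratX_add_ratY_add_ne_zero (1 : F)
  have h2 : ratX F + 1 + ratY F ≠ 0 := by rwa [add_right_comm]
  have h3 : ratX F + (ratY F + 1) ≠ 0 := by rwa [← add_assoc]
  simp only [shiftX, shiftY, map_div₀, map_add, map_sub, map_neg, map_one, ratTranslate_ratX,
    ratTranslate_ratY, Matrix.cons_val_zero, Matrix.cons_val_one, map_zero, add_zero]
  field_simp
  ring

end BivariateSummability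

theorem mainTheorem5 {F : Type*} [Field F] [IsAlgClosed F] [CharZero F] :
    (∀ n : ℕ, 1 ≤ n →
      (IsSummable (shiftX F) (shiftY F) (1 / (ratX F ^ n + ratY F ^ n)) ↔ n = 1)) ∧
    1 / (ratX F + ratY F) =
      shiftX F (ratX F / (ratX F + ratY F)) - ratX F / (ratX F + ratY F)
        + shiftY F ((-ratX F - 1) / (ratX F + ratY F)) - (-ratX F - 1) / (ratX F + ratY F) := by
  refine ⟨fun n hn => ⟨fun h => ?_, ?_⟩, one_div_ratX_add_ratY⟩
  · by_contra hne
    exact not_isSummable_one_div_pow_add_pow (by omega) h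
  · rintro rfl
    exact ⟨_, _, by simpa only [pow_one] using one_div_ratX_add_ratY⟩
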